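/- **Setting.** Consider a finite 2D square lattice, open or with periodic boundary conditions of period at least $3$ in either direction. Each vertex carries a qudit $q$ with Hilbert space $\mathcal H^q$, $1\le\dim\mathcal H^q<\infty$ (different qudits may have different dimensions), and $\mathcal H=\bigotimes_q\mathcal H^q$. Each plaquette $p$ carries a term, also denoted $p$, which is a tensor product $p=\bigotimes_q p^q$ of Hermitian operators $p^q$ on $\mathcal H^q$ (its factors) with $p^q=I$ unless $q$ is one of the four corners of $p$; if $p=0$, the factors at its corners are by convention all $0$. All terms commute pairwise. Then $H=\sum_p p$ is called a factorized commuting 2D plaquette Hamiltonian. A qudit $q$ is *separable* if there is an orthogonal decomposition $\mathcal H^q=\bigoplus_{j=1}^m\mathcal H^q_j$ into $m\ge 2$ non-zero subspaces such that every term $p$ maps $\mathcal H^q_j\otimes\bigotimes_{q'\ne q}\mathcal H^{q'}$ into itself for every $j$. $H$ is *equivalent to a qubit stabilizer Hamiltonian* if there are integers $m^q\ge 0$ and unitary identifications $U^q:\mathcal H^q\to(\mathbb C^2)^{\otimes m^q}$, one for each qudit $q$, such that, with $U=\bigotimes_q U^q$, for every term $p$ the operator $UpU^\dagger$ is a real multiple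 of a tensor product of the matrices $I,X,Y,Z$ on the $\sum_q m^q$ qubits. **Theorem.** Let $H=\sum_p p$ be a factorized commuting 2D plaquette Hamiltonian without separable qudits. Then $H$ is equivalent to a qubit stabilizer Hamiltonian. Moreover: 1. all terms commute in a regular way, i.e. for any two terms $p,\hat p$ and every qudit $q$, $p^q\hat p^q=\hat p^qp^q$ or $p^q\hat p^q=-\hat p^qp^q$; 2. for every term $p$ and every corner $q$ of $p$, $(p^q)^2=c_{pq}I$ for some constant $c_{pq}\in\mathbb R$; 3. for every qudit $q$, the unital $*$-algebra generated by the factors $p^q$ of the terms $p$ having $q$ as a corner is the algebra of all linear operators on $\mathcal H^q$. -/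

import Mathlib

open scoped Matrix

/-! ### Square lattices -/

/-- The four corners of the plaquette whose lower left corner is `p`. -/
def plaquetteCorners {a b : ℕ} (p : ZMod a × ZMod b) : Finset (ZMod a × ZMod b) :=
  {p, p + (1, 0), p + (0, 1), p + (1, 1)}

/-- A finite 2D square lattice (vertices and plaquettes).  Since `ZMod 0 = ℤ`, a period `0` in one
direction means that the lattice is open in that direction; a direction may also be periodic, of
period at least 3 (so that distinct plaquettes have at most two common vertices).
A plaquette is named by its lower left corner. -/
structure SquareLattice where
  period₁ : ℕ
  period₂ : ℕ
  period₁_eq : period₁ = 0 ∨ 3 ≤ period₁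
  period₂_eq : period₂ = 0 ∨ 3 ≤ period₂
  vertices : Finset (ZMod period₁ × ZMod period₂)
  plaquettes : Finset (ZMod period₁ × ZMod period₂)
  corners_subset : ∀ p ∈ plaquettes, plaquetteCorners p ⊆ vertices

/-- The vertices of the lattice; there is one qudit on each of them. -/
abbrev SquareLattice.Vertex (L : SquareLattice) : Type := {v // v ∈ L.vertices}

/-- The plaquettes of the lattice. -/
abbrev SquareLattice.Plaquette (L : SquareLattice) : Type := {p // p ∈ L.plaquettes}

/-- The (four) qudits on the corners of a plaquette. -/
def SquareLattice.corners (L : SquareLattice) (p : L.Plaquette) : Set L.Vertex :=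
  {q | q.1 ∈ plaquetteCorners p.1}

/-! ### Operators on systems of qudits -/

section Qudits

variable {ι : Type} [Fintype ι] [DecidableEq ι]

/-- The tensor product `⨂ i, A i` of matrices, in the product bases: the space `⨂ i, ℂ ^ (n i)` has
the basis `∀ i, n i`. -/
def tensorOp {m n : ι → Type} (A : ∀ i, Matrix (m i) (n i) ℂ) :
    Matrix (∀ i, m i) (∀ i, n i) ℂ :=
  Matrix.of fun x y => ∏ i, A i (x i) (y i)

/-- Operators on the space of one qudit of dimension `d`. -/
abbrev SiteOp (d : ℕ) : Type := Matrix (Fin d) (Fin d) ℂ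

/-- Operators on the space `⨂ q, ℂ ^ (d q)` of all qudits. -/
abbrev QuditOp (d : ι → ℕ) : Type := Matrix (∀ q, Fin (d q)) (∀ q, Fin (d q)) ℂ

/-- The operator on all qudits that acts as `A` on the qudit `q` and as the identity elsewhere. -/
def onSite {d : ι → ℕ} (q : ι) (A : SiteOp (d q)) : QuditOp d :=
  tensorOp (Function.update (fun q' => (1 : SiteOp (d q'))) q A)

/-- `f` is a family of factors of the term `h`, which acts on the qudits in `S`: it consists of
Hermitian operators, is trivial outside `S`, and `h = ⨂ q, f q`; by convention the factors on `S` of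
the zero term are all zero. -/
structure IsFactorization {d : ι → ℕ} (S : Set ι) (f : ∀ q, SiteOp (d q)) (h : QuditOp d) :
    Prop where
  isHermitian : ∀ q, (f q).IsHermitian
  eq_one : ∀ q, q ∉ S → f q = 1
  eq_tensorOp : h = tensorOp f
  eq_zero : h = 0 → ∀ q ∈ S, f q = 0

/-- The term `h` is a tensor product of Hermitian operators on the qudits in `S`. -/
def IsFactorized {d : ι → ℕ} (S : Set ι) (h : QuditOp d) : Prop :=
  ∃ f : ∀ q, SiteOp (d q), IsFactorization S f h

/-- The qudit `q` is separable with respect to the terms `h`: its space has a non-trivial orthogonal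
decomposition into non-zero subspaces, given by the projections `E j` onto them, such that every
term maps each subspace `range (E j) ⊗ (all the other qudits)` into itself. -/
def IsSeparableQudit {d : ι → ℕ} {T : Type} (h : T → QuditOp d) (q : ι) : Prop :=
  ∃ (m : ℕ) (E : Fin m → SiteOp (d q)), 2 ≤ m ∧
    (∀ j, (E j).IsHermitian) ∧ CompleteOrthogonalIdempotents E ∧ (∀ j, E j ≠ 0) ∧
    ∀ t j, onSite q (E j) * h t * onSite q (E j) = h t * onSite q (E j)

/-- Two families of factors commute in a regular way: on every qudit they commute or
anticommute. -/
def CommuteRegular {d : ι → ℕ} (f g : ∀ q, SiteOp (d q)) : Prop :=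
  ∀ q, f q * g q = g q * f q ∨ f q * g q = -(g q * f q)

/-! ### Pauli operators and qubit stabilizer Hamiltonians -/

/-- The labels of the four single-qubit Pauli matrices. -/
inductive Pauli
  | I | X | Y | Z

/-- The single-qubit Pauli matrices. -/
def Pauli.toMatrix : Pauli → Matrix (Fin 2) (Fin 2) ℂ
  | I => 1
  | X => !![0, 1; 1, 0]
  | Y => !![0, -Complex.I; Complex.I, 0]
  | Z => !![1, 0; 0, -1]

/-- The tensor product of Pauli matrices on `k` qubits. -/
def pauliString {k : ℕ} (s : Fin k → Pauli) : Matrix (Fin k → Fin 2) (Fin k → Fin 2) ℂ :=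
  tensorOp fun i => (s i).toMatrix

/-- The Hamiltonian `∑ t, h t` is equivalent to a qubit stabilizer Hamiltonian: each qudit `q` is
identified with `m q` qubits by a unitary `U q`, and this turns every term `h t` into a real multiple
of a tensor product of Pauli matrices on all these qubits. -/
def IsEquivQubitStabilizer {d : ι → ℕ} {T : Type} (h : T → QuditOp d) : Prop :=
  ∃ (m : ι → ℕ) (U : ∀ q, Matrix (Fin (m q) → Fin 2) (Fin (d q)) ℂ),
    (∀ q, (U q)ᴴ * U q = 1 ∧ U q * (U q)ᴴ = 1) ∧
    ∀ t, ∃ (c : ℝ) (s : ∀ q, Fin (m q) → Pauli),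
      tensorOp U * h t * (tensorOp U)ᴴ = (c : ℂ) • tensorOp fun q => pauliString (s q)

end Qudits

/-!
The terms commute while their factors need not, and the proof shows that nevertheless the factors
commute up to sign on every qudit.

*No separable qudit* means that the factors on each qudit act irreducibly
(`actsIrreducibly_of_not_isSeparableQudit`): the orthogonal projection onto a common invariant
subspace would commute with all of them. Burnside's theorem, here a consequence of the Jacobson
density theorem, then says that the factors generate the full matrix algebra, and by Schur's lemma
anything that commutes with all factors is a scalar. In particular, once all factors commute or
anticommute, their squares are scalars.

*Commutation up to sign.* Two plaquettes with a single common vertex have commuting factors there.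
If two plaquettes share an edge, comparing the tensor products in the two orders shows that either
the factors commute or anticommute at both ends, or they annihilate each other at some end
(`IsFactorization.exists_mul_eq_zero`). So a failure of commutation up to sign at one end of an edge
(an *outgoing* edge there) forces nonzero factors with product zero at the other end (an *incoming*
edge there). At a vertex with an incoming edge both perpendicular edges are outgoing, as otherwise
one of the two annihilating factors would have a scalar square and be invertible
(`not_commOrAnticomm_of_mul_eq_zero`). Hence rotation by a right angle maps incoming to outgoing
half-edges and passing to the other end maps outgoing to incoming ones, both injectively; on a
finite lattice both maps are bijections. Consequently the half-edge opposite to an incoming one is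
incoming, which contradicts irreducibility (`mul_ne_zero_of_opposite`). So there are no outgoing edges at all
(`SquareLattice.vertexFactor_commOrAnticomm`).

*Pauli form.* An irreducible family of Hermitian operators that commute or anticommute consists of
multiples of Pauli strings in a suitable orthonormal basis (`exists_pauli_basis`): as long as two of
them anticommute, they split off a qubit on which they act as `Z` and `X`, and after multiplication
by Pauli operators on that qubit the whole family acts on the remaining tensor factor.
-/

/-! ### Irreducible families of operators -/

section Irreducible

variable {K V J : Type*} [Field K] [AddCommGroup V] [Module K V]

/-- A family of operators acts irreducibly if its only common invariant subspaces are the trivial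
ones. -/
def ActsIrreducibly (T : J → Module.End K V) : Prop :=
  ∀ W : Submodule K V, (∀ j, ∀ w ∈ W, T j w ∈ W) → W = ⊥ ∨ W = ⊤

/-- **Schur's lemma** for an irreducible family. -/
theorem ActsIrreducibly.exists_eq_smul_one [IsAlgClosed K] [FiniteDimensional K V] [Nontrivial V]
    {T : J → Module.End K V} (hT : ActsIrreducibly T) {B : Module.End K V}
    (hB : ∀ j, T j * B = B * T j) : ∃ c : K, B = c • 1 := by
  obtain ⟨c, hc⟩ := Module.End.exists_eigenvalue B
  refine ⟨c, ?_⟩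
  have hinv : ∀ j, ∀ w ∈ B.eigenspace c, T j w ∈ B.eigenspace c := by
    intro j w hw
    rw [Module.End.mem_eigenspace_iff] at hw ⊢
    have := congr($(hB j) w)
    simp only [Module.End.mul_apply, hw, map_smul] at this
    exact this.symm
  rcases hT (B.eigenspace c) hinv with h | h
  · exact absurd h hc
  · ext v
    have : v ∈ B.eigenspace c := h ▸ Submodule.mem_top
    simpa using Module.End.mem_eigenspace_iff.mp this

/-- **Burnside's theorem**: an irreducible family of operators generates the algebra of all
operators. -/
theorem ActsIrreducibly.adjoin_eq_top [IsAlgClosed K] [FiniteDimensional K V] [Nontrivial V]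
    {T : J → Module.End K V} (hT : ActsIrreducibly T) :
    Algebra.adjoin K (Set.range T) = ⊤ := by
  set R := Algebra.adjoin K (Set.range T) with hR
  have hmem : ∀ j, T j ∈ R := fun j => Algebra.subset_adjoin ⟨j, rfl⟩
  have : IsSimpleModule R V := by
    refine (isSimpleModule_iff R V).mpr
      { exists_pair_ne := ⟨⊥, ⊤, bot_ne_top⟩
        eq_bot_or_eq_top := fun W => ?_ }
    rcases hT (W.restrictScalars K) (fun j w hw => W.smul_mem ⟨T j, hmem j⟩ hw) with h | h
    · left
      simpa using h
    · right
      simpa using h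
  rw [eq_top_iff]
  intro f _
  -- `f` commutes with the endomorphisms of the `R`-module `V`, since these are scalars
  let F : Module.End (Module.End R V) V :=
    { toFun := f
      map_add' := map_add f
      map_smul' := fun φ v => by
        obtain ⟨c, hc⟩ := hT.exists_eq_smul_one (B := φ.restrictScalars K) (fun j => by
          ext v
          exact (φ.map_smul (⟨T j, hmem j⟩ : R) v).symm)
        have hφ : ∀ v, φ v = c • v := fun v => by simpa using congr($hc v)
        simp [hφ] }
  classical
  let b := Module.finBasis K V
  obtain ⟨r, hr⟩ := jacobson_density F (Finset.univ.image b)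
  have : f = r.1 := b.ext fun i => hr (b i) (Finset.mem_image_of_mem b (Finset.mem_univ i))
  exact this ▸ r.2

end Irreducible

/-! ### Operators that commute or anticommute -/

/-- Two elements of a ring commute or anticommute. -/
def CommOrAnticomm {R : Type*} [Ring R] (a b : R) : Prop :=
  a * b = b * a ∨ a * b = -(b * a)

namespace CommOrAnticomm

variable {R : Type*} [Ring R] {a b c : R}

theorem refl (a : R) : CommOrAnticomm a a := Or.inl rfl

theorem symm (h : CommOrAnticomm a b) : CommOrAnticomm b a := by
  rcases h with h | h
  · exact Or.inl h.symm
  · exact Or.inr (by rw [h, neg_neg])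

theorem one_right (a : R) : CommOrAnticomm a 1 := Or.inl (by simp)

theorem mul_right (hb : CommOrAnticomm a b) (hc : CommOrAnticomm a c) :
    CommOrAnticomm a (b * c) := by
  rcases hb with hb | hb <;> rcases hc with hc | hc
  · exact Or.inl (by rw [← mul_assoc, hb, mul_assoc, hc, mul_assoc])
  · exact Or.inr (by rw [← mul_assoc, hb, mul_assoc, hc, mul_neg, mul_assoc])
  · exact Or.inr (by rw [← mul_assoc, hb, neg_mul, mul_assoc, hc, mul_assoc])
  · exact Or.inl (by rw [← mul_assoc, hb, neg_mul, mul_assoc, hc, mul_neg, neg_neg, mul_assoc])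

theorem mul_left (ha : CommOrAnticomm a c) (hb : CommOrAnticomm b c) :
    CommOrAnticomm (a * b) c :=
  (ha.symm.mul_right hb.symm).symm

theorem smul_right {K : Type*} [CommRing K] [Algebra K R] (k : K) (h : CommOrAnticomm a b) :
    CommOrAnticomm a (k • b) := by
  rcases h with h | h
  · exact Or.inl (by simp [h])
  · exact Or.inr (by simp [h])

/-- The square of an element commutes with everything the element commutes or anticommutes with. -/
theorem sq_comm (h : CommOrAnticomm a b) : b * (a * a) = a * a * b := by
  rcases h with h | h
  · rw [← mul_assoc, ← h, mul_assoc, ← h, mul_assoc]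
  · have h' : b * a = -(a * b) := by rw [h, neg_neg]
    rw [← mul_assoc, h', neg_mul, mul_assoc, h', mul_neg, neg_neg, mul_assoc]

end CommOrAnticomm

/-! ### Pauli operators on an inner product space -/

section PauliBasis

variable {V : Type*} [NormedAddCommGroup V] [InnerProductSpace ℂ V]

theorem LinearMap.IsSymmetric.eq_zero_of_mul_self {A : Module.End ℂ V} (hA : A.IsSymmetric)
    (h : A * A = 0) : A = 0 := by
  ext v
  rw [LinearMap.zero_apply, ← inner_self_eq_zero (𝕜 := ℂ), hA, ← Module.End.mul_apply, h]
  simp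

/-- A symmetric operator with scalar square has a real nonnegative square. -/
theorem LinearMap.IsSymmetric.exists_mul_self_eq_smul [Nontrivial V] {A : Module.End ℂ V}
    (hA : A.IsSymmetric) {c : ℂ} (h : A * A = c • 1) : ∃ r : ℝ, 0 ≤ r ∧ c = (r : ℂ) := by
  obtain ⟨v, hv⟩ := exists_ne (0 : V)
  have h1 : inner ℂ (A v) (A v) = c * inner ℂ v v := by
    rw [hA, ← Module.End.mul_apply, h, LinearMap.smul_apply, inner_smul_right, Module.End.one_apply]
  rw [inner_self_eq_norm_sq_to_K, inner_self_eq_norm_sq_to_K] at h1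
  have hv' : ‖v‖ ^ 2 ≠ 0 := by simpa using hv
  refine ⟨‖A v‖ ^ 2 / ‖v‖ ^ 2, by positivity, ?_⟩
  have hv2 : ((‖v‖ : ℂ)) ^ 2 ≠ 0 := by exact_mod_cast hv'
  push_cast
  rw [eq_div_iff hv2]
  exact h1.symm

/-- The operators `1`, `X`, `i X Z`, `Z` that play the role of the four Pauli matrices, for a pair
of anticommuting operators `X` and `Z`. -/
def pauliOp (X Z : Module.End ℂ V) : Pauli → Module.End ℂ V
  | .I => 1
  | .X => X
  | .Y => Complex.I • (X * Z)
  | .Z => Z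

variable {X Z : Module.End ℂ V}

theorem pauliOp_mul_self (hX : X * X = 1) (hZ : Z * Z = 1) (hZX : Z * X = -(X * Z)) (P : Pauli) :
    pauliOp X Z P * pauliOp X Z P = 1 := by
  cases P
  · simp [pauliOp]
  · simpa [pauliOp] using hX
  · have : X * Z * (X * Z) = -1 := by
      rw [mul_assoc, ← mul_assoc Z, hZX, neg_mul, mul_assoc X Z Z, hZ, mul_one, mul_neg, hX]
    simp [pauliOp, smul_smul, this]
  · simpa [pauliOp] using hZ

theorem pauliOp_isSymmetric (hX : X.IsSymmetric) (hZ : Z.IsSymmetric) (hZX : Z * X = -(X * Z))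
    (P : Pauli) : (pauliOp X Z P).IsSymmetric := by
  cases P
  · exact LinearMap.IsSymmetric.one
  · exact hX
  · intro v w
    have : Z (X v) = - X (Z v) := congr($hZX v)
    simp only [pauliOp, LinearMap.smul_apply, Module.End.mul_apply, inner_smul_left,
      inner_smul_right, Complex.conj_I]
    rw [← hX, ← hZ, this, inner_neg_left]
    ring
  · exact hZ

theorem CommOrAnticomm.pauliOp_right {S : Module.End ℂ V} (hX : CommOrAnticomm S X)
    (hZ : CommOrAnticomm S Z) (P : Pauli) : CommOrAnticomm S (pauliOp X Z P) := by
  cases P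
  · exact CommOrAnticomm.one_right S
  · exact hX
  · exact (hX.mul_right hZ).smul_right _
  · exact hZ

/-- An operator that commutes or anticommutes with `X` and with `Z` commutes with both after
multiplication by a suitable Pauli operator, with which it commutes. -/
theorem exists_pauliOp_mul_comm (hZX : Z * X = -(X * Z)) {S : Module.End ℂ V}
    (hSX : CommOrAnticomm S X) (hSZ : CommOrAnticomm S Z) :
    ∃ P, S * pauliOp X Z P = pauliOp X Z P * S ∧
      X * (pauliOp X Z P * S) = pauliOp X Z P * S * X ∧
      Z * (pauliOp X Z P * S) = pauliOp X Z P * S * Z := by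
  rcases hSX with hX | hX <;> rcases hSZ with hZ | hZ
  · exact ⟨.I, by simp [pauliOp, hX, hZ]⟩
  · refine ⟨.X, hX, ?_, ?_⟩
    · simp only [pauliOp]
      rw [mul_assoc, hX]
    · simp only [pauliOp]
      rw [mul_assoc, hZ, mul_neg, ← mul_assoc, hZX, neg_mul, mul_assoc]
  · refine ⟨.Z, hZ, ?_, ?_⟩
    · simp only [pauliOp]
      rw [mul_assoc, hX, mul_neg, ← mul_assoc, ← mul_assoc, hZX, neg_mul, neg_neg]
    · simp only [pauliOp]
      rw [mul_assoc, hZ]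
  · have h1 : S * (X * Z) = X * Z * S := by
      rw [← mul_assoc, hX, neg_mul, mul_assoc, hZ, mul_neg, neg_neg, mul_assoc]
    refine ⟨.Y, by simp [pauliOp, h1], ?_, ?_⟩
    · simp only [pauliOp, smul_mul_assoc, mul_smul_comm]
      rw [mul_assoc (X * Z) S X, hX, mul_neg, ← mul_assoc (X * Z) X S, mul_assoc X Z X, hZX,
        mul_neg, neg_mul, neg_neg, mul_assoc X (X * Z) S]
    · simp only [pauliOp, smul_mul_assoc, mul_smul_comm]
      rw [mul_assoc _ S Z, hZ, mul_neg, ← mul_assoc, ← mul_assoc, ← mul_assoc, hZX, neg_mul,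
        neg_mul]

/-- On the space spanned by `v` and `X v`, where `Z v = v`, the operator `pauliOp X Z P` acts as the
Pauli matrix `P`. -/
theorem pauliOp_apply (hX : X * X = 1) (hZX : Z * X = -(X * Z)) {v : V} (hv : Z v = v)
    (P : Pauli) (i : Fin 2) :
    pauliOp X Z P ((![1, X] : Fin 2 → Module.End ℂ V) i v) =
      ∑ j, P.toMatrix j i • (![1, X] : Fin 2 → Module.End ℂ V) j v := by
  have h1 : Z (X v) = - X v := by
    have : Z (X v) = - X (Z v) := congr($hZX v)
    rw [this, hv]
  have h2 : X (X v) = v := congr($hX v)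
  fin_cases i <;> cases P <;> simp [pauliOp, Pauli.toMatrix, Matrix.one_apply, hv, h1, h2]

end PauliBasis

/-! ### Pauli bases -/

section PauliBasis

variable {V : Type*} [NormedAddCommGroup V] [InnerProductSpace ℂ V]

theorem pauliString_cons {m : ℕ} (P : Pauli) (s : Fin m → Pauli) (i j : Fin 2)
    (x y : Fin m → Fin 2) :
    pauliString (Fin.cons P s : Fin (m + 1) → Pauli) (Fin.cons i x : Fin (m + 1) → Fin 2)
      (Fin.cons j y : Fin (m + 1) → Fin 2) = P.toMatrix i j * pauliString s x y := by
  simp [pauliString, tensorOp, Fin.prod_univ_succ]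

/-- For anticommuting symmetric involutions `X` and `Z`, an orthonormal basis of the `1`-eigenspace
of `Z` and its image under `X` form an orthonormal basis of the whole space. -/
theorem exists_orthonormalBasis_cons {X Z : Module.End ℂ V} (hXs : X.IsSymmetric)
    (hZs : Z.IsSymmetric) (hX : X * X = 1) (hZ : Z * Z = 1) (hZX : Z * X = -(X * Z)) {m : ℕ}
    (b : OrthonormalBasis (Fin m → Fin 2) ℂ (Z.eigenspace 1)) :
    ∃ b' : OrthonormalBasis (Fin (m + 1) → Fin 2) ℂ V, ∀ i x,
      b' (Fin.cons i x : Fin (m + 1) → Fin 2) =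
        (![1, X] : Fin 2 → Module.End ℂ V) i (b x : V) := by
  have hZX' : ∀ v, Z (X v) = -X (Z v) := fun v => congr($hZX v)
  have hX' : ∀ v, X (X v) = v := fun v => congr($hX v)
  have hZ' : ∀ v, Z (Z v) = v := fun v => congr($hZ v)
  have hb : ∀ x, Z (b x : V) = b x := fun x => by
    simpa using Module.End.mem_eigenspace_iff.mp (b x).2
  have hbon : ∀ x y, inner ℂ (b x : V) (b y) = if x = y then (1 : ℂ) else 0 := fun x y =>
    orthonormal_iff_ite.mp b.orthonormal x y
  have horth : ∀ x y, inner ℂ (b x : V) (X (b y)) = 0 := by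
    intro x y
    have h1 : inner ℂ (Z (b x : V)) (X (b y)) = inner ℂ (b x : V) (Z (X (b y))) := hZs _ _
    rw [hb, hZX', hb, inner_neg_right] at h1
    exact self_eq_neg.mp h1
  let e : Fin 2 × (Fin m → Fin 2) → V :=
    fun z => (![1, X] : Fin 2 → Module.End ℂ V) z.1 (b z.2 : V)
  have hon : Orthonormal ℂ e := by
    rw [orthonormal_iff_ite]
    rintro ⟨i, x⟩ ⟨j, y⟩
    fin_cases i <;> fin_cases j
    · simp [e, hbon]
    · simp [e, horth]
    · simp [e, hXs _ _, horth]
    · simp [e, hXs _ _, hX', hbon]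
  have hmem : ∀ i, ∀ u ∈ Z.eigenspace 1,
      (![1, X] : Fin 2 → Module.End ℂ V) i u ∈ Submodule.span ℂ (Set.range e) := by
    intro i u hu
    have h1 : u = ∑ x, b.repr ⟨u, hu⟩ x • (b x : V) := by
      have := congr((($(b.sum_repr ⟨u, hu⟩) : Z.eigenspace 1) : V))
      simpa using this.symm
    rw [h1, map_sum]
    refine Submodule.sum_mem _ fun x _ => ?_
    rw [map_smul]
    exact Submodule.smul_mem _ _ (Submodule.subset_span ⟨(i, x), rfl⟩)
  have hsp : ⊤ ≤ Submodule.span ℂ (Set.range e) := by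
    intro v _
    have h0 := hmem 0 ((2⁻¹ : ℂ) • (v + Z v)) (by
      rw [Module.End.mem_eigenspace_iff]
      simp [hZ', add_comm])
    have h1 := hmem 1 ((2⁻¹ : ℂ) • X (v - Z v)) (by
      rw [Module.End.mem_eigenspace_iff]
      simp only [one_smul, map_smul, map_sub, hZ', hZX']
      congr 1
      abel)
    have h2 : v = (2⁻¹ : ℂ) • (v + Z v) + X ((2⁻¹ : ℂ) • X (v - Z v)) := by
      rw [map_smul, hX', ← smul_add, add_add_sub_cancel, ← two_smul ℂ v, smul_smul]
      norm_num
    rw [h2]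
    exact Submodule.add_mem _ h0 h1
  refine ⟨(OrthonormalBasis.mk hon hsp).reindex (Fin.consEquiv fun _ => Fin 2), fun i x => ?_⟩
  rw [OrthonormalBasis.reindex_apply, OrthonormalBasis.coe_mk,
    show (Fin.cons i x : Fin (m + 1) → Fin 2) = Fin.consEquiv (fun _ => Fin 2) (i, x) from rfl,
    Equiv.symm_apply_apply]

/-- A nonzero symmetric operator that commutes or anticommutes with all members of an irreducible
family has a real multiple that is a symmetric involution. -/
theorem exists_involution {J : Type*} [FiniteDimensional ℂ V] [Nontrivial V]
    {T : J → Module.End ℂ V} (hirr : ActsIrreducibly T) {A : Module.End ℂ V}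
    (hA : A.IsSymmetric) (hA0 : A ≠ 0) (hca : ∀ j, CommOrAnticomm A (T j)) :
    ∃ r : ℝ, (((r : ℂ) • A) * ((r : ℂ) • A) = 1) ∧ ((r : ℂ) • A).IsSymmetric := by
  obtain ⟨c, hc⟩ := hirr.exists_eq_smul_one fun j => (hca j).sq_comm
  obtain ⟨s, hs0, rfl⟩ := hA.exists_mul_self_eq_smul hc
  have hs : s ≠ 0 := by
    rintro rfl
    exact hA0 (hA.eq_zero_of_mul_self (by simpa using hc))
  refine ⟨(√s)⁻¹, ?_, hA.smul (by simp)⟩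
  rw [smul_mul_smul_comm, hc, smul_smul, ← Complex.ofReal_mul, ← Complex.ofReal_mul, ← mul_inv,
    Real.mul_self_sqrt hs0, inv_mul_cancel₀ hs, Complex.ofReal_one, one_smul]

end PauliBasis

/-- An irreducible family of symmetric operators that pairwise commute or anticommute consists, in a
suitable orthonormal basis, of real multiples of Pauli strings. The proof is by induction on the
dimension: an anticommuting pair `X`, `Z` splits off a qubit, and, up to Pauli operators on that
qubit, the family acts on the `1`-eigenspace of `Z`. -/
theorem exists_pauli_basis (n : ℕ) : ∀ (V : Type) [NormedAddCommGroup V] [InnerProductSpace ℂ V]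
    [FiniteDimensional ℂ V] [Nontrivial V] {J : Type} (T : J → Module.End ℂ V),
    Module.finrank ℂ V ≤ n → (∀ j, (T j).IsSymmetric) → (∀ i j, CommOrAnticomm (T i) (T j)) →
    ActsIrreducibly T →
    ∃ (m : ℕ) (b : OrthonormalBasis (Fin m → Fin 2) ℂ V), ∀ j, ∃ (c : ℝ) (s : Fin m → Pauli),
      ∀ x, T j (b x) = (c : ℂ) • ∑ y, pauliString s y x • b y := by
  induction n with
  | zero =>
    intro V _ _ _ _ J T hn
    have := Module.finrank_pos (R := ℂ) (M := V)
    omega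
  | succ n ih =>
    intro V _ _ _ _ J T hn hsym hca hirr
    by_cases hcomm : ∀ i j, T i * T j = T j * T i
    · -- all operators are scalars, so that `V` is a line
      have hscal : ∀ j, ∃ c : ℂ, T j = c • 1 := fun j =>
        hirr.exists_eq_smul_one fun i => hcomm i j
      obtain ⟨v, hv⟩ := exists_norm_eq V (c := 1) zero_le_one
      have hv0 : v ≠ 0 := by
        rintro rfl
        simp at hv
      have htop : Submodule.span ℂ {v} = ⊤ := by
        refine (hirr (Submodule.span ℂ {v}) fun j w hw => ?_).resolve_left ?_
        · obtain ⟨c, hc⟩ := hscal j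
          rw [hc]
          exact Submodule.smul_mem _ c hw
        · simpa using hv0
      have hon : Orthonormal ℂ fun _ : Fin 0 → Fin 2 => v :=
        ⟨fun _ => hv, fun i j hij => absurd (Subsingleton.elim i j) hij⟩
      refine ⟨0, OrthonormalBasis.mk hon (by simp [htop]), fun j => ?_⟩
      obtain ⟨c, hc⟩ := hscal j
      have hreal : (starRingEnd ℂ) c = c := by
        have := hsym j v v
        rw [hc] at this
        simpa [inner_smul_left, inner_smul_right, hv] using this
      obtain ⟨r, rfl⟩ := Complex.conj_eq_iff_real.mp hreal
      exact ⟨r, fun _ => Pauli.I, fun x => by simp [hc, pauliString, tensorOp]⟩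
    · push Not at hcomm
      have : IsAddTorsionFree V := .of_isTorsionFree ℂ V
      obtain ⟨i₀, j₀, hne⟩ := hcomm
      have hanti := (hca i₀ j₀).resolve_left hne
      obtain ⟨r, hZ, hZs⟩ := exists_involution hirr (hsym i₀) (by rintro h; simp [h] at hne)
        (hca i₀)
      obtain ⟨r', hX, hXs⟩ := exists_involution hirr (hsym j₀) (by rintro h; simp [h] at hne)
        (hca j₀)
      set Z := (r : ℂ) • T i₀ with hZdef
      set X := (r' : ℂ) • T j₀ with hXdef
      have hZX : Z * X = -(X * Z) := by
        rw [hZdef, hXdef, smul_mul_smul_comm, hanti, smul_neg, smul_mul_smul_comm, mul_comm (r : ℂ)]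
      have hcX : ∀ j, CommOrAnticomm (T j) X := fun j => (hca j j₀).smul_right _
      have hcZ : ∀ j, CommOrAnticomm (T j) Z := fun j => (hca j i₀).smul_right _
      choose P hP hPX hPZ using fun j => exists_pauliOp_mul_comm hZX (hcX j) (hcZ j)
      have hZX' : ∀ v, Z (X v) = -X (Z v) := fun v => congr($hZX v)
      have hX' : ∀ v, X (X v) = v := fun v => congr($hX v)
      have hPP := pauliOp_mul_self hX hZ hZX
      have hTP : ∀ j, T j = pauliOp X Z (P j) * (pauliOp X Z (P j) * T j) := fun j => by
        rw [← mul_assoc, hPP, one_mul]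
      set T' : J → Module.End ℂ V := fun j => pauliOp X Z (P j) * T j with hT'
      have hT'sym : ∀ j, (T' j).IsSymmetric := fun j => by
        refine ((pauliOp_isSymmetric hXs hZs hZX (P j)).mul_of_commute (hsym j) ?_)
        exact (hP j).symm
      have hinv : ∀ j, ∀ v ∈ Z.eigenspace 1, T' j v ∈ Z.eigenspace 1 := by
        intro j v hv
        rw [Module.End.mem_eigenspace_iff, one_smul] at hv ⊢
        have : Z (T' j v) = T' j (Z v) := congr($(hPZ j) v)
        rw [this, hv]
      have hT'X : ∀ j v, T' j (X v) = X (T' j v) := fun j v => by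
        have := (hPX j).symm
        exact congr($this v)
      have hXP : ∀ Q, CommOrAnticomm X (pauliOp X Z Q) := fun Q =>
        (CommOrAnticomm.refl X).pauliOp_right (Or.inr (by rw [hZX, neg_neg])) Q
      have hZP : ∀ Q, CommOrAnticomm Z (pauliOp X Z Q) := fun Q =>
        CommOrAnticomm.pauliOp_right (Or.inr hZX) (CommOrAnticomm.refl Z) Q
      have hca' : ∀ i j, CommOrAnticomm (T' i) (T' j) := fun i j => by
        have hPP' : CommOrAnticomm (pauliOp X Z (P i)) (pauliOp X Z (P j)) :=
          CommOrAnticomm.pauliOp_right (hXP _).symm (hZP _).symm _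
        exact (hPP'.mul_right ((hcX j).pauliOp_right (hcZ j) _).symm).mul_left
          (((hcX i).pauliOp_right (hcZ i) _).mul_right (hca i j))
      -- an invariant subspace `W` of the eigenspace yields the invariant subspace `W + X W`
      have hirr' : ActsIrreducibly fun j => (T' j).restrict (hinv j) := by
        intro W hW
        set W₁ : Submodule ℂ V := W.map (Z.eigenspace 1).subtype
        have hW₁ : ∀ w ∈ W₁, Z w = w := by
          rintro _ ⟨w, hw, rfl⟩
          simpa using Module.End.mem_eigenspace_iff.mp w.2
        have hW₁T : ∀ j, ∀ w ∈ W₁, T' j w ∈ W₁ := by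
          rintro j _ ⟨w, hw, rfl⟩
          exact ⟨_, hW j w hw, rfl⟩
        set W₂ := W₁ ⊔ W₁.map X with hW₂
        have hmemX : ∀ w ∈ W₂, X w ∈ W₂ := by
          intro w hw
          obtain ⟨a, ha, _, ⟨b, hb, rfl⟩, rfl⟩ := Submodule.mem_sup.mp hw
          rw [map_add, hX', add_comm]
          exact Submodule.add_mem_sup hb ⟨a, ha, rfl⟩
        have hmemZ : ∀ w ∈ W₂, Z w ∈ W₂ := by
          intro w hw
          obtain ⟨a, ha, _, ⟨b, hb, rfl⟩, rfl⟩ := Submodule.mem_sup.mp hw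
          rw [map_add, hZX', hW₁ a ha, hW₁ b hb]
          exact Submodule.add_mem_sup ha (Submodule.neg_mem _ ⟨b, hb, rfl⟩)
        have hmemT' : ∀ j, ∀ w ∈ W₂, T' j w ∈ W₂ := by
          intro j w hw
          obtain ⟨a, ha, _, ⟨b, hb, rfl⟩, rfl⟩ := Submodule.mem_sup.mp hw
          rw [map_add, hT'X]
          exact Submodule.add_mem_sup (hW₁T j a ha) ⟨_, hW₁T j b hb, rfl⟩
        have hmemP : ∀ Q, ∀ w ∈ W₂, pauliOp X Z Q w ∈ W₂ := by
          intro Q w hw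
          cases Q
          · exact hw
          · exact hmemX w hw
          · exact Submodule.smul_mem _ _ (hmemX _ (hmemZ w hw))
          · exact hmemZ w hw
        rcases hirr W₂ (fun j w hw => by
          rw [hTP j]
          exact hmemP _ _ (hmemT' j w hw)) with h | h
        · left
          have : W₁ = ⊥ := le_bot_iff.mp (h ▸ le_sup_left)
          exact Submodule.map_injective_of_injective (Z.eigenspace 1).injective_subtype
            (this.trans (Submodule.map_bot _).symm)
        · right
          rw [eq_top_iff]
          rintro ⟨v, hv⟩ -
          have hv2 : v ∈ W₂ := h ▸ Submodule.mem_top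
          obtain ⟨a, ha, _, ⟨b, hb, rfl⟩, rfl⟩ := Submodule.mem_sup.mp hv2
          rw [Module.End.mem_eigenspace_iff, one_smul, map_add, hZX', hW₁ a ha, hW₁ b hb,
            add_right_inj, neg_eq_self] at hv
          obtain ⟨w, hw, hwa⟩ := ha
          convert! hw
          simp [hv, ← hwa]
      have hne_bot : Z.eigenspace 1 ≠ ⊥ := by
        intro h
        have hZ1 : ∀ v, Z v = -v := fun v => by
          have : v + Z v ∈ Z.eigenspace 1 := by
            rw [Module.End.mem_eigenspace_iff, map_add, one_smul, add_comm]
            exact congr($hZ v + Z v)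
          rw [h, Submodule.mem_bot] at this
          exact (neg_eq_of_add_eq_zero_right this).symm
        obtain ⟨v, hv⟩ := exists_ne (0 : V)
        have h1 := hZX' v
        rw [hZ1, hZ1, map_neg, neg_neg, neg_eq_self] at h1
        exact hv (by rw [← hX' v, h1, map_zero])
      have hne_top : Z.eigenspace 1 ≠ ⊤ := by
        intro h
        have hZ1 : ∀ v, Z v = v := fun v => by
          have : v ∈ Z.eigenspace 1 := h ▸ Submodule.mem_top
          simpa using Module.End.mem_eigenspace_iff.mp this
        obtain ⟨v, hv⟩ := exists_ne (0 : V)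
        have h1 := hZX' v
        rw [hZ1, hZ1, self_eq_neg] at h1
        exact hv (by rw [← hX' v, h1, map_zero])
      have := Submodule.nontrivial_iff_ne_bot.mpr hne_bot
      have hlt := Submodule.finrank_lt hne_top
      obtain ⟨m, b, hb⟩ := ih (Z.eigenspace 1) (fun j => (T' j).restrict (hinv j)) (by omega)
        (fun j => (hT'sym j).restrict_invariant (hinv j))
        (fun i j => by
          rcases hca' i j with h | h
          · left
            ext v
            exact congr($h v)
          · right
            ext v
            exact congr($h v)) hirr'
      obtain ⟨b', hb'⟩ := exists_orthonormalBasis_cons hXs hZs hX hZ hZX b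
      refine ⟨m + 1, b', fun j => ?_⟩
      obtain ⟨c, s, hcs⟩ := hb j
      refine ⟨c, Fin.cons (P j) s, fun z => ?_⟩
      obtain ⟨⟨i, x⟩, rfl⟩ := (Fin.consEquiv fun _ => Fin 2).surjective z
      change T j (b' (Fin.cons i x)) = (c : ℂ) • ∑ y, pauliString (Fin.cons (P j) s)
        y (Fin.cons i x) • b' y
      have hcomm' : ∀ v, T' j ((![1, X] : Fin 2 → Module.End ℂ V) i v) =
          (![1, X] : Fin 2 → Module.End ℂ V) i (T' j v) := by
        intro v
        fin_cases i
        · rfl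
        · exact hT'X j v
      have hcs' : T' j (b x : V) = (c : ℂ) • ∑ y, pauliString s y x • (b y : V) := by
        simpa using congr((($(hcs x) : Z.eigenspace 1) : V))
      rw [hb', hTP j, Module.End.mul_apply, hcomm', hcs', map_smul, map_smul, map_sum, map_sum,
        ← (Fin.consEquiv fun _ => Fin 2).sum_comp, Fintype.sum_prod_type, Finset.sum_comm]
      congr 1
      refine Finset.sum_congr rfl fun y _ => ?_
      have hby : Z (b y : V) = b y := by
        simpa using Module.End.mem_eigenspace_iff.mp (b y).2
      rw [map_smul, map_smul, pauliOp_apply hX hZX hby, Finset.smul_sum]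
      refine Finset.sum_congr rfl fun k _ => ?_
      change _ = pauliString (Fin.cons (P j) s) (Fin.cons k y) (Fin.cons i x) • b' (Fin.cons k y)
      rw [pauliString_cons, hb', smul_smul, mul_comm]

/-! ### Tensor products of matrices -/

section TensorOp

variable {ι : Type} [Fintype ι]

theorem tensorOp_mul [DecidableEq ι] {k m n : ι → Type} [∀ i, Fintype (m i)]
    (A : ∀ i, Matrix (k i) (m i) ℂ) (B : ∀ i, Matrix (m i) (n i) ℂ) :
    tensorOp A * tensorOp B = tensorOp fun i => A i * B i := by
  ext x y
  simp only [tensorOp, Matrix.mul_apply, Matrix.of_apply]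
  rw [Finset.prod_univ_sum, Fintype.piFinset_univ]
  exact Finset.sum_congr rfl fun z _ => Finset.prod_mul_distrib.symm

theorem tensorOp_conjTranspose {m n : ι → Type} (A : ∀ i, Matrix (m i) (n i) ℂ) :
    (tensorOp A)ᴴ = tensorOp fun i => (A i)ᴴ := by
  ext x y
  simp [tensorOp, Matrix.conjTranspose_apply]

theorem tensorOp_smul {m n : ι → Type} (c : ι → ℂ) (A : ∀ i, Matrix (m i) (n i) ℂ) :
    (tensorOp fun i => c i • A i) = (∏ i, c i) • tensorOp A := by
  ext x y
  simp [tensorOp, Finset.prod_mul_distrib]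

theorem tensorOp_eq_zero {m n : ι → Type} {A : ∀ i, Matrix (m i) (n i) ℂ} {i : ι} (h : A i = 0) :
    tensorOp A = 0 := by
  ext x y
  exact Finset.prod_eq_zero (Finset.mem_univ i) (by simp [h])

/-- If two tensor products agree, then so do their factors at `v`, up to the product of matrix
entries of the other factors. -/
theorem smul_eq_smul_of_tensorOp_eq [DecidableEq ι] {m n : ι → Type}
    {A B : ∀ i, Matrix (m i) (n i) ℂ} (h : tensorOp A = tensorOp B) (v : ι)
    (hA : ∀ i, i ≠ v → A i ≠ 0) :
    ∃ α β : ℂ, α ≠ 0 ∧ α • A v = β • B v ∧ ((∀ i, i ≠ v → A i = B i) → α = β) := by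
  have hex : ∀ i, i ≠ v → ∃ z : m i × n i, A i z.1 z.2 ≠ 0 := by
    intro i hi
    by_contra! h0
    exact hA i hi (by ext x y; exact h0 (x, y))
  rcases isEmpty_or_nonempty (m v × n v) with hE | ⟨⟨z₀⟩⟩
  · refine ⟨1, 1, one_ne_zero, ?_, fun _ => rfl⟩
    ext x y
    exact hE.elim (x, y)
  choose z hz using fun i => show ∃ z : m i × n i, i ≠ v → A i z.1 z.2 ≠ 0 by
    by_cases hi : i = v
    · subst hi
      exact ⟨z₀, fun h => absurd rfl h⟩
    · obtain ⟨z, hz⟩ := hex i hi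
      exact ⟨z, fun _ => hz⟩
  refine ⟨∏ i ∈ {v}ᶜ, A i (z i).1 (z i).2, ∏ i ∈ {v}ᶜ, B i (z i).1 (z i).2, ?_, ?_, fun hAB => ?_⟩
  · exact Finset.prod_ne_zero_iff.mpr fun i hi => hz i (by simpa using hi)
  · ext x y
    have key : ∀ C : ∀ i, Matrix (m i) (n i) ℂ,
        tensorOp C (Function.update (fun i => (z i).1) v x)
          (Function.update (fun i => (z i).2) v y) =
          (∏ i ∈ {v}ᶜ, C i (z i).1 (z i).2) * C v x y := by
      intro C
      rw [tensorOp, Matrix.of_apply, Fintype.prod_eq_mul_prod_compl v, mul_comm]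
      congr 1
      · refine Finset.prod_congr rfl fun i hi => ?_
        have hi : i ≠ v := by simpa using hi
        simp [hi]
      · simp
    simp only [Matrix.smul_apply, smul_eq_mul]
    rw [← key A, ← key B, h]
  · exact Finset.prod_congr rfl fun i hi => by rw [hAB i (by simpa using hi)]

end TensorOp

/-! ### Commuting tensor products of Hermitian matrices -/

section Factorization

open scoped ComplexOrder in
/-- Hermitian matrices whose products in the two orders are proportional commute or anticommute:
for `A B = c B A`, comparing the traces of `A B B A = c ^ 2 B B A A` gives `c ^ 2 = 1`. -/
theorem commOrAnticomm_of_smul_eq_smul {n : Type*} [Fintype n] [DecidableEq n]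
    {A B : Matrix n n ℂ} (hA : A.IsHermitian) (hB : B.IsHermitian) {α β : ℂ} (hα : α ≠ 0)
    (h : α • (A * B) = β • (B * A)) : CommOrAnticomm A B := by
  have hBA : B * A = (A * B)ᴴ := by rw [Matrix.conjTranspose_mul, hA, hB]
  by_cases h0 : A * B = 0
  · left
    rw [hBA, h0, Matrix.conjTranspose_zero]
  set c := α⁻¹ * β with hc
  have h1 : A * B = c • (B * A) := by
    rw [hc, mul_smul, ← h, smul_smul, inv_mul_cancel₀ hα, one_smul]
  have h2 : A * B * (B * A) = (c * c) • (B * B * A * A) := by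
    calc A * B * (B * A) = c • (B * A) * (B * A) := by rw [← h1]
      _ = c • (B * (A * B) * A) := by simp only [smul_mul_assoc, mul_assoc]
      _ = c • (B * (c • (B * A)) * A) := by rw [← h1]
      _ = _ := by simp only [smul_mul_assoc, mul_smul_comm, smul_smul, mul_assoc]
  have htr : (A * B * (B * A)).trace ≠ 0 := by
    rw [hBA]
    exact fun h => h0 (Matrix.trace_mul_conjTranspose_self_eq_zero_iff.mp h)
  have h3 : (B * B * A * A).trace = (A * B * (B * A)).trace := by
    rw [Matrix.trace_mul_comm]
    simp only [mul_assoc]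
  have h4 := congr_arg Matrix.trace h2
  rw [Matrix.trace_smul, h3, smul_eq_mul] at h4
  rcases mul_self_eq_one_iff.mp (mul_right_cancel₀ htr (h4.symm.trans (one_mul _).symm))
    with h5 | h5
  · exact Or.inl (by rw [h1, h5, one_smul])
  · exact Or.inr (by rw [h1, h5, neg_one_smul])

variable {ι : Type} [Fintype ι] {d : ι → ℕ} {S S' : Set ι}
  {f f' : ∀ q, SiteOp (d q)} {h h' : QuditOp d}

theorem IsFactorization.commute_of_eq_zero (hf : IsFactorization S f h) (h0 : h = 0) (v : ι)
    (B : SiteOp (d v)) : f v * B = B * f v := by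
  by_cases hv : v ∈ S
  · simp [hf.eq_zero h0 v hv]
  · simp [hf.eq_one v hv]

theorem IsFactorization.ne_zero (hf : IsFactorization S f h) (h0 : h ≠ 0) (v : ι) : f v ≠ 0 :=
  fun hv => h0 (hf.eq_tensorOp.trans (tensorOp_eq_zero hv))

variable [DecidableEq ι]

theorem IsFactorization.tensorOp_mul_eq (hf : IsFactorization S f h)
    (hf' : IsFactorization S' f' h') (hh : h * h' = h' * h) :
    (tensorOp fun q => f q * f' q) = tensorOp fun q => f' q * f q := by
  rw [← tensorOp_mul, ← tensorOp_mul, ← hf.eq_tensorOp, ← hf'.eq_tensorOp, hh]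

/-- Factors of commuting terms that neither commute nor anticommute on one qudit are nonzero with
vanishing product on another qudit. -/
theorem IsFactorization.exists_mul_eq_zero (hf : IsFactorization S f h)
    (hf' : IsFactorization S' f' h') (hh : h * h' = h' * h) {v : ι}
    (hv : ¬ CommOrAnticomm (f v) (f' v)) :
    ∃ r, r ≠ v ∧ r ∈ S ∧ r ∈ S' ∧ f r * f' r = 0 ∧ f r ≠ 0 ∧ f' r ≠ 0 := by
  have h0 : h ≠ 0 := fun h0 => hv (Or.inl (hf.commute_of_eq_zero h0 v _))
  have h0' : h' ≠ 0 := fun h0 => hv (Or.inl (hf'.commute_of_eq_zero h0 v _).symm)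
  by_contra! hcon
  obtain ⟨α, β, hα, hαβ, -⟩ := smul_eq_smul_of_tensorOp_eq (hf.tensorOp_mul_eq hf' hh) v
    (fun r hr hz => by
      by_cases hS : r ∈ S
      · by_cases hS' : r ∈ S'
        · exact hf'.ne_zero h0' r (hcon r hr hS hS' hz (hf.ne_zero h0 r))
        · rw [hf'.eq_one r hS', mul_one] at hz
          exact hf.ne_zero h0 r hz
      · rw [hf.eq_one r hS, one_mul] at hz
        exact hf'.ne_zero h0' r hz)
  exact hv (commOrAnticomm_of_smul_eq_smul (hf.isHermitian v) (hf'.isHermitian v) hα hαβ)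

/-- Factors of commuting terms with only one common qudit commute. -/
theorem IsFactorization.commute_of_subsingleton (hf : IsFactorization S f h)
    (hf' : IsFactorization S' f' h') (hh : h * h' = h' * h) {v : ι}
    (hS : ∀ r, r ∈ S → r ∈ S' → r = v) : f v * f' v = f' v * f v := by
  by_cases h0 : h = 0
  · exact hf.commute_of_eq_zero h0 v _
  by_cases h0' : h' = 0
  · exact (hf'.commute_of_eq_zero h0' v _).symm
  have hone : ∀ r, r ≠ v → f r = 1 ∨ f' r = 1 := fun r hr => by
    by_cases hrS : r ∈ S
    · exact Or.inr (hf'.eq_one r fun hrS' => hr (hS r hrS hrS'))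
    · exact Or.inl (hf.eq_one r hrS)
  obtain ⟨α, β, hα, hαβ, heq⟩ := smul_eq_smul_of_tensorOp_eq (hf.tensorOp_mul_eq hf' hh) v
    (fun r hr => by
      rcases hone r hr with h1 | h1
      · rw [h1, one_mul]
        exact hf'.ne_zero h0' r
      · rw [h1, mul_one]
        exact hf.ne_zero h0 r)
  obtain rfl := heq fun r hr => by
    rcases hone r hr with h1 | h1 <;> simp [h1]
  exact smul_right_injective _ hα hαβ

end Factorization

/-! ### Separability -/

section Separability

variable {ι : Type} [Fintype ι] [DecidableEq ι] {d : ι → ℕ} {T : Type} {h : T → QuditOp d}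
  {S : T → Set ι} {f : T → ∀ q, SiteOp (d q)}

/-- A nontrivial Hermitian projection that commutes with all factors on `q` makes `q` separable. -/
theorem isSeparableQudit_of_commute (hf : ∀ t, IsFactorization (S t) (f t) (h t)) {q : ι}
    {E : SiteOp (d q)} (hE : E.IsHermitian) (hEE : E * E = E) (h0 : E ≠ 0) (h1 : E ≠ 1)
    (hc : ∀ t, E * f t q = f t q * E) : IsSeparableQudit h q := by
  have key : ∀ F : SiteOp (d q), F * F = F → (∀ t, F * f t q = f t q * F) →
      ∀ t, onSite q F * h t * onSite q F = h t * onSite q F := by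
    intro F hFF hF t
    rw [(hf t).eq_tensorOp, onSite, tensorOp_mul, tensorOp_mul, tensorOp_mul]
    congr 1
    funext r
    by_cases hr : r = q
    · subst hr
      simp [hF t, mul_assoc, hFF]
    · simp [hr]
  refine ⟨2, ![E, 1 - E], le_rfl, ?_, ?_, ?_, fun t j => ?_⟩
  · intro j
    fin_cases j
    · exact hE
    · exact Matrix.isHermitian_one.sub hE
  · have hid : IsIdempotentElem E := hEE
    refine ⟨⟨fun j => ?_, fun i j hij => ?_⟩, by simp⟩
    · fin_cases j
      · exact hid
      · exact hid.one_sub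
    · fin_cases i <;> fin_cases j
      · exact absurd rfl hij
      · simp [mul_sub, hEE]
      · simp [sub_mul, hEE]
      · exact absurd rfl hij
  · intro j
    fin_cases j
    · exact h0
    · exact sub_ne_zero.mpr h1.symm
  · fin_cases j
    · exact key E hEE hc t
    · exact key (1 - E) (IsIdempotentElem.one_sub hEE)
        (fun t => by rw [sub_mul, mul_sub, hc t, one_mul, mul_one]) t

/-- The factors on a qudit that is not separable act irreducibly. -/
theorem actsIrreducibly_of_not_isSeparableQudit
    (hf : ∀ t, IsFactorization (S t) (f t) (h t)) {q : ι} (hq : ¬ IsSeparableQudit h q) :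
    ActsIrreducibly fun t : {t // q ∈ S t} => (f t.1 q).toEuclideanLin := by
  intro W hW
  by_contra! hne
  let Φ := Matrix.toEuclideanCLM (n := Fin (d q)) (𝕜 := ℂ)
  set E : SiteOp (d q) := Φ.symm W.starProjection with hEdef
  have hΦE : Φ E = W.starProjection := Φ.apply_symm_apply _
  have hE : E.IsHermitian := by
    have : star (Φ E) = Φ E := by
      rw [hΦE]
      exact isSelfAdjoint_starProjection W
    rw [← map_star] at this
    exact EquivLike.injective Φ this
  have hEE : E * E = E := EquivLike.injective Φ (by
    rw [map_mul, hΦE]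
    exact W.isIdempotentElem_starProjection)
  refine hq (isSeparableQudit_of_commute hf hE hEE ?_ ?_ fun t => ?_)
  · intro h0
    apply hne.1
    rw [h0, map_zero] at hΦE
    rw [eq_bot_iff]
    intro w hw
    rw [← W.starProjection_eq_self_iff.mpr hw, ← hΦE]
    simp
  · intro h1
    apply hne.2
    rw [h1, map_one] at hΦE
    rw [eq_top_iff]
    intro w _
    rw [← W.starProjection_eq_self_iff, ← hΦE]
    rfl
  · by_cases ht : q ∈ S t
    · have h2 : E * (f t q * E) = f t q * E := EquivLike.injective Φ (by
        rw [map_mul, map_mul, hΦE]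
        ext1 v
        exact W.starProjection_eq_self_iff.mpr (hW ⟨t, ht⟩ _ (W.starProjection_apply_mem v)))
      have h3 := congr_arg Matrix.conjTranspose h2
      rw [Matrix.conjTranspose_mul, Matrix.conjTranspose_mul, hE, (hf t).isHermitian q,
        mul_assoc, h2] at h3
      exact h3.symm
    · simp [(hf t).eq_one q ht]

end Separability

/-! ### The factors around a vertex -/

section LocalLemmas

variable {d : ℕ}

theorem eq_zero_symm_of_isHermitian {A B : SiteOp d} (hA : A.IsHermitian) (hB : B.IsHermitian)
    (h : A * B = 0) : B * A = 0 := by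
  rw [← hA.eq, ← hB.eq, ← Matrix.conjTranspose_mul, h, Matrix.conjTranspose_zero]

/-- **Schur's lemma** for matrices. -/
theorem ActsIrreducibly.exists_matrix_eq_smul_one {J : Type*} {A : J → SiteOp d} (hd : 0 < d)
    (hirr : ActsIrreducibly fun j => (A j).toEuclideanLin) {B : SiteOp d}
    (hB : ∀ j, A j * B = B * A j) : ∃ c : ℂ, B = c • 1 := by
  have : Nonempty (Fin d) := ⟨⟨0, hd⟩⟩
  let e := Matrix.toLpLinAlgEquiv (R := ℂ) (n := Fin d) 2
  obtain ⟨c, hc⟩ := hirr.exists_eq_smul_one (B := e B) (fun j => by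
    change e (A j) * e B = e B * e (A j)
    rw [← map_mul, hB, map_mul])
  exact ⟨c, e.injective (by rw [hc, map_smul, map_one])⟩

theorem ActsIrreducibly.starAlgebra_adjoin_eq_top {J : Type*} {A : J → SiteOp d} (hd : 0 < d)
    (hirr : ActsIrreducibly fun j => (A j).toEuclideanLin) :
    StarAlgebra.adjoin ℂ (Set.range A) = ⊤ := by
  have : Nonempty (Fin d) := ⟨⟨0, hd⟩⟩
  let e := Matrix.toLpLinAlgEquiv (R := ℂ) (n := Fin d) 2
  rw [eq_top_iff]
  intro M _
  have h1 : e M ∈ (Algebra.adjoin ℂ (Set.range A)).map (e : SiteOp d →ₐ[ℂ] _) := by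
    rw [AlgHom.map_adjoin, ← Set.range_comp]
    exact hirr.adjoin_eq_top ▸ Algebra.mem_top
  obtain ⟨M', hM', hMM'⟩ := h1
  obtain rfl := e.injective hMM'
  exact Algebra.adjoin_le (S := (StarAlgebra.adjoin ℂ (Set.range A)).toSubalgebra)
    (StarAlgebra.subset_adjoin ℂ _) hM'

/-- A Hermitian matrix that commutes or anticommutes with all members of an irreducible family has a
scalar square. -/
theorem ActsIrreducibly.exists_mul_self_eq {J : Type*} {A : J → SiteOp d} (hd : 0 < d)
    (hirr : ActsIrreducibly fun j => (A j).toEuclideanLin) {C : SiteOp d} (hC : C.IsHermitian)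
    (hca : ∀ j, CommOrAnticomm C (A j)) :
    ∃ c : ℝ, C * C = (c : ℂ) • (1 : SiteOp d) := by
  obtain ⟨c, hc⟩ := hirr.exists_matrix_eq_smul_one hd fun j => (hca j).sq_comm
  have hreal : (starRingEnd ℂ) c = c := by
    have h1 : (C * C)ᴴ = C * C := by rw [Matrix.conjTranspose_mul, hC]
    rw [hc] at h1
    simpa using congr($h1 ⟨0, hd⟩ ⟨0, hd⟩)
  obtain ⟨r, rfl⟩ := Complex.conj_eq_iff_real.mp hreal
  exact ⟨r, hc⟩

/-- In an irreducible family, a nonzero Hermitian matrix that commutes or anticommutes with all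
members is invertible, so that no nonzero matrix annihilates it. -/
theorem ActsIrreducibly.eq_zero_of_mul_eq_zero {J : Type*} {A : J → SiteOp d} (hd : 0 < d)
    (hirr : ActsIrreducibly fun j => (A j).toEuclideanLin) {C D : SiteOp d} (hC : C.IsHermitian)
    (hC0 : C ≠ 0) (hca : ∀ j, CommOrAnticomm C (A j)) (hCD : C * D = 0) : D = 0 := by
  obtain ⟨c, hc⟩ := hirr.exists_mul_self_eq hd hC hca
  have hc0 : (c : ℂ) ≠ 0 := by
    intro h0
    rw [h0, zero_smul] at hc
    have : Cᴴ * C = 0 := by rw [hC.eq, hc]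
    open scoped ComplexOrder in
    exact hC0 (Matrix.conjTranspose_mul_self_eq_zero.mp this)
  have h1 : (c : ℂ) • D = 0 := by
    calc (c : ℂ) • D = C * C * D := by rw [hc, smul_mul_assoc, one_mul]
      _ = 0 := by rw [mul_assoc, hCD, mul_zero]
  exact (smul_eq_zero.mp h1).resolve_left hc0

theorem Fin.four_cases (i j : Fin 4) : j = i ∨ j = i + 1 ∨ j = i + 2 ∨ j = i + 3 := by
  revert i j
  decide

variable {A : Fin 4 → SiteOp d}

/-- If two adjacent factors around a vertex annihilate each other, then each of them neither
commutes nor anticommutes with its other neighbour. -/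
theorem not_commOrAnticomm_of_mul_eq_zero (hd : 0 < d)
    (hirr : ActsIrreducibly fun j => (A j).toEuclideanLin) (hA : ∀ i, (A i).IsHermitian)
    (hdiag : ∀ i, A i * A (i + 2) = A (i + 2) * A i) {i : Fin 4} (h0 : A i * A (i + 1) = 0)
    (hi : A i ≠ 0) (hi' : A (i + 1) ≠ 0) :
    ¬ CommOrAnticomm (A (i + 1)) (A (i + 2)) ∧ ¬ CommOrAnticomm (A (i + 3)) (A i) := by
  have h0' : A (i + 1) * A i = 0 := eq_zero_symm_of_isHermitian (hA _) (hA _) h0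
  constructor
  · intro h
    refine hi (hirr.eq_zero_of_mul_eq_zero hd (hA _) hi' (fun j => ?_) h0')
    rcases Fin.four_cases i j with rfl | rfl | rfl | rfl
    · exact Or.inl (by rw [h0, h0'])
    · exact CommOrAnticomm.refl _
    · exact h
    · have := hdiag (i + 1)
      rw [add_assoc] at this
      exact Or.inl this
  · intro h
    refine hi' (hirr.eq_zero_of_mul_eq_zero hd (hA _) hi (fun j => ?_) h0)
    rcases Fin.four_cases i j with rfl | rfl | rfl | rfl
    · exact CommOrAnticomm.refl _
    · exact Or.inl (by rw [h0, h0'])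
    · exact Or.inl (hdiag i)
    · exact h.symm

/-- The four factors around a vertex cannot annihilate each other in two disjoint adjacent pairs:
then the products of diagonal factors would be central, hence zero, and the two remaining adjacent
pairs would act on orthogonal subspaces. -/
theorem mul_ne_zero_of_opposite (hd : 0 < d)
    (hirr : ActsIrreducibly fun j => (A j).toEuclideanLin) (hA : ∀ i, (A i).IsHermitian)
    (hdiag : ∀ i, A i * A (i + 2) = A (i + 2) * A i) {i : Fin 4} (h01 : A i * A (i + 1) = 0)
    (hi : A i ≠ 0) (hi' : A (i + 1) ≠ 0) : A (i + 2) * A (i + 3) ≠ 0 := by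
  intro h23
  have h10 : A (i + 1) * A i = 0 := eq_zero_symm_of_isHermitian (hA _) (hA _) h01
  have h32 : A (i + 3) * A (i + 2) = 0 := eq_zero_symm_of_isHermitian (hA _) (hA _) h23
  have hd02 := hdiag i
  have hd13 : A (i + 1) * A (i + 3) = A (i + 3) * A (i + 1) := by
    have := hdiag (i + 1)
    rwa [add_assoc] at this
  -- the two products of diagonal factors commute with all four factors
  have h02 : A i * A (i + 2) = 0 := by
    obtain ⟨c, hc⟩ := hirr.exists_matrix_eq_smul_one hd (B := A i * A (i + 2)) (fun j => by
      rcases Fin.four_cases i j with rfl | rfl | rfl | rfl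
      · rw [mul_assoc (A j), ← hd02]
      · rw [← mul_assoc, h10, hd02, mul_assoc, h01, zero_mul, mul_zero]
      · rw [hd02, mul_assoc (A (i + 2)), hd02]
      · rw [mul_assoc (A i), h23, hd02, ← mul_assoc, h32, zero_mul, mul_zero])
    have h1 : c • A (i + 1) = 0 := by
      calc c • A (i + 1) = A (i + 1) * (A i * A (i + 2)) := by rw [hc, mul_smul_comm, mul_one]
        _ = 0 := by rw [← mul_assoc, h10, zero_mul]
    rw [hc, (smul_eq_zero.mp h1).resolve_right hi', zero_smul]
  have h13 : A (i + 1) * A (i + 3) = 0 := by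
    obtain ⟨c, hc⟩ := hirr.exists_matrix_eq_smul_one hd (B := A (i + 1) * A (i + 3)) (fun j => by
      rcases Fin.four_cases i j with rfl | rfl | rfl | rfl
      · rw [← mul_assoc, h01, hd13, mul_assoc, h10, zero_mul, mul_zero]
      · rw [mul_assoc (A (i + 1)), ← hd13]
      · rw [mul_assoc (A (i + 1)), h32, hd13, ← mul_assoc, h23, zero_mul, mul_zero]
      · rw [hd13, mul_assoc (A (i + 3)), hd13])
    have h1 : c • A i = 0 := by
      calc c • A i = A i * (A (i + 1) * A (i + 3)) := by rw [hc, mul_smul_comm, mul_one]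
        _ = 0 := by rw [← mul_assoc, h01, zero_mul]
    rw [hc, (smul_eq_zero.mp h1).resolve_right hi, zero_smul]
  have h20 : A (i + 2) * A i = 0 := hd02 ▸ h02
  have happ : ∀ {B C : SiteOp d}, B * C = 0 → ∀ v, B.toEuclideanLin (C.toEuclideanLin v) = 0 := by
    intro B C h v
    have := congr(Matrix.toEuclideanLin $h v)
    rw [Matrix.toLpLin_mul_same] at this
    simpa using this
  -- `A (i + 1)` and `A (i + 2)` vanish on the span of the ranges of `A i` and `A (i + 3)`
  set W := LinearMap.range (A i).toEuclideanLin ⊔ LinearMap.range (A (i + 3)).toEuclideanLin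
  have hkill : ∀ j, A j * A i = 0 → A j * A (i + 3) = 0 → ∀ w ∈ W, (A j).toEuclideanLin w = 0 := by
    intro j h1 h2 w hw
    obtain ⟨_, ⟨a, rfl⟩, _, ⟨b, rfl⟩, rfl⟩ := Submodule.mem_sup.mp hw
    rw [map_add, happ h1, happ h2, add_zero]
  have hzero : ∀ {B : SiteOp d}, (∀ v, B.toEuclideanLin v = 0) → B = 0 := fun h =>
    Matrix.toEuclideanLin.injective (by
      rw [map_zero]
      exact LinearMap.ext h)
  rcases hirr W (fun j w hw => by
    rcases Fin.four_cases i j with rfl | rfl | rfl | rfl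
    · exact (le_sup_left : _ ≤ W) ⟨w, rfl⟩
    · rw [hkill _ h10 h13 w hw]
      exact W.zero_mem
    · rw [hkill _ h20 h23 w hw]
      exact W.zero_mem
    · exact (le_sup_right : _ ≤ W) ⟨w, rfl⟩) with h | h
  · refine hi (hzero fun v => ?_)
    have : (A i).toEuclideanLin v ∈ W := (le_sup_left : _ ≤ W) ⟨v, rfl⟩
    rwa [h, Submodule.mem_bot] at this
  · exact hi' (hzero fun v => hkill _ h10 h13 v (h ▸ Submodule.mem_top))

end LocalLemmas

/-! ### Corners of plaquettes -/

section Geometry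

/-- The corners of a plaquette in cyclic order, relative to the lower left one. The plaquettes
around a vertex `v` are, in cyclic order, `v - cornerOffset i`. -/
def cornerOffset {a b : ℕ} : Fin 4 → ZMod a × ZMod b := ![(0, 0), (1, 0), (1, 1), (0, 1)]

variable {a b : ℕ}

theorem mem_plaquetteCorners {p v : ZMod a × ZMod b} :
    v ∈ plaquetteCorners p ↔ ∃ i, p = v - cornerOffset i := by
  simp only [plaquetteCorners, cornerOffset, Finset.mem_insert, Finset.mem_singleton,
    Fin.exists_fin_succ, eq_sub_iff_add_eq, eq_comm (a := v)]
  simp [← Prod.zero_eq_mk, or_comm (a := p + (1, 1) = v)]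

theorem cornerOffset_sub (i : Fin 4) :
    (cornerOffset (i + 3) : ZMod a × ZMod b) - cornerOffset i =
      cornerOffset (i + 2) - cornerOffset (i + 1) := by
  fin_cases i <;> simp [cornerOffset]

/-- A period `0` or at least `3` keeps the differences `-1`, `0`, `1` of coordinates of corners
distinct. -/
theorem ZMod.one_ne_zero_and_one_ne_neg_one (ha : a = 0 ∨ 3 ≤ a) :
    (1 : ZMod a) ≠ 0 ∧ (1 : ZMod a) ≠ -1 := by
  have key : ∀ k : ℕ, 0 < k → k < 3 → (k : ZMod a) ≠ 0 := by
    intro k hk hk3 h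
    rw [ZMod.natCast_eq_zero_iff] at h
    rcases ha with rfl | ha
    · have := Nat.eq_zero_of_zero_dvd h
      omega
    · have := Nat.le_of_dvd hk h
      omega
  refine ⟨by simpa using key 1 (by omega) (by omega), fun h => ?_⟩
  apply key 2 (by omega) (by omega)
  rw [eq_neg_iff_add_eq_zero] at h
  push_cast
  rw [← h]
  norm_num

theorem exists_eq_add_cornerOffset {v r : ZMod a × ZMod b} {i : Fin 4}
    (h : r ∈ plaquetteCorners (v - cornerOffset i)) :
    ∃ k, r = v + (cornerOffset k - cornerOffset i) := by
  obtain ⟨k, hk⟩ := mem_plaquetteCorners.mp h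
  refine ⟨k, ?_⟩
  rw [← add_sub_assoc, add_sub_right_comm, hk, sub_add_cancel]

/-- Two adjacent plaquettes at `v` meet in `v` and in one neighbour of `v`. With a period of at most
2 they could have further common vertices. -/
theorem eq_or_eq_of_mem_adjacent (ha : a = 0 ∨ 3 ≤ a) (hb : b = 0 ∨ 3 ≤ b)
    {v r : ZMod a × ZMod b} {i : Fin 4} (h : r ∈ plaquetteCorners (v - cornerOffset i))
    (h' : r ∈ plaquetteCorners (v - cornerOffset (i + 1))) :
    r = v ∨ r = v + (cornerOffset (i + 3) - cornerOffset i) := by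
  obtain ⟨h1, h2⟩ := ZMod.one_ne_zero_and_one_ne_neg_one ha
  obtain ⟨h3, h4⟩ := ZMod.one_ne_zero_and_one_ne_neg_one hb
  obtain ⟨k, rfl⟩ := exists_eq_add_cornerOffset h
  obtain ⟨l, hl⟩ := exists_eq_add_cornerOffset h'
  rw [add_right_inj] at hl
  rw [add_eq_left, add_right_inj]
  fin_cases i <;> fin_cases k <;> fin_cases l <;>
    simp_all [cornerOffset, Prod.ext_iff, eq_comm (a := (0 : ZMod _))]

/-- Two diagonally opposite plaquettes at `v` meet only in `v`. -/
theorem eq_of_mem_diagonal (ha : a = 0 ∨ 3 ≤ a) (hb : b = 0 ∨ 3 ≤ b)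
    {v r : ZMod a × ZMod b} {i : Fin 4} (h : r ∈ plaquetteCorners (v - cornerOffset i))
    (h' : r ∈ plaquetteCorners (v - cornerOffset (i + 2))) : r = v := by
  obtain ⟨h1, h2⟩ := ZMod.one_ne_zero_and_one_ne_neg_one ha
  obtain ⟨h3, h4⟩ := ZMod.one_ne_zero_and_one_ne_neg_one hb
  obtain ⟨k, rfl⟩ := exists_eq_add_cornerOffset h
  obtain ⟨l, hl⟩ := exists_eq_add_cornerOffset h'
  rw [add_right_inj] at hl
  rw [add_eq_left]
  fin_cases i <;> fin_cases k <;> fin_cases l <;>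
    simp_all [cornerOffset, Prod.ext_iff, eq_comm (a := (0 : ZMod _))]

end Geometry

/-! ### Excluding singular edges -/

/-- If a map `ρ` sends a finite set `I` injectively into `O`, and `O` can be mapped injectively back
into `I`, then `ρ` maps `I` onto `O`. -/
theorem Set.image_eq_of_mutual_injOn {X : Type*} [Finite X] {I O : Set X} {ρ φ : X → X}
    (hρ : Function.Injective ρ) (hρI : ∀ x ∈ I, ρ x ∈ O) (hφ : Set.InjOn φ O)
    (hφO : ∀ x ∈ O, φ x ∈ I) : ρ '' I = O := by
  refine Set.eq_of_subset_of_ncard_le (by rintro _ ⟨x, hx, rfl⟩; exact hρI x hx) ?_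
  rw [Set.ncard_image_of_injective I hρ]
  exact Set.ncard_le_ncard_of_injOn φ hφO hφ

namespace SquareLattice

variable {L : SquareLattice} {d : L.Vertex → ℕ} {h : L.Plaquette → QuditOp d}
  {f : L.Plaquette → ∀ q, SiteOp (d q)}

/-- The factors on the vertex `v` of the terms on the four plaquettes around `v`, in cyclic order;
the factor of a missing plaquette is taken to be zero. -/
noncomputable def vertexFactor (f : L.Plaquette → ∀ q, SiteOp (d q)) (v : L.Vertex) (i : Fin 4) :
    SiteOp (d v) :=
  open Classical in
  if hp : v.1 - cornerOffset i ∈ L.plaquettes then f ⟨_, hp⟩ v else 0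

theorem vertexFactor_eq {p : L.Plaquette} {v : L.Vertex} {i : Fin 4}
    (hp : p.1 = v.1 - cornerOffset i) : vertexFactor f v i = f p v := by
  obtain ⟨p, hpL⟩ := p
  subst hp
  exact dif_pos hpL

theorem vertexFactor_eq_zero_or_exists (f : L.Plaquette → ∀ q, SiteOp (d q)) (v : L.Vertex)
    (i : Fin 4) : vertexFactor f v i = 0 ∨
      ∃ p : L.Plaquette, p.1 = v.1 - cornerOffset i ∧ vertexFactor f v i = f p v := by
  by_cases hp : v.1 - cornerOffset i ∈ L.plaquettes
  · exact Or.inr ⟨⟨_, hp⟩, rfl, dif_pos hp⟩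
  · exact Or.inl (dif_neg hp)

theorem mem_corners {p : L.Plaquette} {v : L.Vertex} :
    v ∈ L.corners p ↔ ∃ i, p.1 = v.1 - cornerOffset i := mem_plaquetteCorners

theorem mem_plaquetteCorners_of_mem_corners {p : L.Plaquette} {v : L.Vertex}
    {x : ZMod L.period₁ × ZMod L.period₂} (hv : v ∈ L.corners p) (hp : p.1 = x) :
    v.1 ∈ plaquetteCorners x := by
  subst hp
  exact hv

variable (hf : ∀ p, IsFactorization (L.corners p) (f p) (h p))
include hf

theorem vertexFactor_isHermitian (v : L.Vertex) (i : Fin 4) :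
    (vertexFactor f v i).IsHermitian := by
  rcases vertexFactor_eq_zero_or_exists f v i with h0 | ⟨p, -, hp⟩
  · rw [h0]
    exact Matrix.isHermitian_zero
  · rw [hp]
    exact (hf p).isHermitian v

theorem vertexFactor_actsIrreducibly {v : L.Vertex} (hv : ¬ IsSeparableQudit h v) :
    ActsIrreducibly fun i => (vertexFactor f v i).toEuclideanLin := by
  intro W hW
  refine actsIrreducibly_of_not_isSeparableQudit hf hv W ?_
  rintro ⟨p, hp⟩ w hw
  obtain ⟨i, hi⟩ := mem_corners.mp hp
  have : (vertexFactor f v i).toEuclideanLin w ∈ W := hW i w hw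
  rwa [vertexFactor_eq hi] at this

variable (hcommute : ∀ p p', h p * h p' = h p' * h p)
include hcommute

theorem vertexFactor_comm_diagonal (v : L.Vertex) (i : Fin 4) :
    vertexFactor f v i * vertexFactor f v (i + 2) =
      vertexFactor f v (i + 2) * vertexFactor f v i := by
  rcases vertexFactor_eq_zero_or_exists f v i with h0 | ⟨p, hp, hpv⟩
  · simp [h0]
  rcases vertexFactor_eq_zero_or_exists f v (i + 2) with h0 | ⟨p', hp', hpv'⟩
  · simp [h0]
  rw [hpv, hpv']
  refine (hf p).commute_of_subsingleton (hf p') (hcommute p p') fun r hr hr' => Subtype.ext ?_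
  exact eq_of_mem_diagonal L.period₁_eq L.period₂_eq (mem_plaquetteCorners_of_mem_corners hr hp)
    (mem_plaquetteCorners_of_mem_corners hr' hp')

/-- If two adjacent factors around `v` neither commute nor anticommute, then the factors of the same
two terms on the other common vertex are nonzero and annihilate each other. -/
theorem exists_vertexFactor_mul_eq_zero {v : L.Vertex} {i : Fin 4}
    (hv : ¬ CommOrAnticomm (vertexFactor f v i) (vertexFactor f v (i + 1))) :
    ∃ w : L.Vertex, w.1 = v.1 + (cornerOffset (i + 3) - cornerOffset i) ∧
      vertexFactor f w (i + 2) * vertexFactor f w (i + 3) = 0 ∧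
      vertexFactor f w (i + 2) ≠ 0 ∧ vertexFactor f w (i + 3) ≠ 0 := by
  rcases vertexFactor_eq_zero_or_exists f v i with h0 | ⟨p, hp, hpv⟩
  · exact absurd (Or.inl (by simp [h0])) hv
  rcases vertexFactor_eq_zero_or_exists f v (i + 1) with h0 | ⟨p', hp', hpv'⟩
  · exact absurd (Or.inl (by simp [h0])) hv
  rw [hpv, hpv'] at hv
  obtain ⟨w, hwv, hwp', hwp, hmul, h0', h0⟩ := (hf p').exists_mul_eq_zero (hf p) (hcommute p' p)
    fun hca => hv hca.symm
  have hw : w.1 = v.1 + (cornerOffset (i + 3) - cornerOffset i) :=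
    (eq_or_eq_of_mem_adjacent L.period₁_eq L.period₂_eq
      (mem_plaquetteCorners_of_mem_corners hwp hp)
      (mem_plaquetteCorners_of_mem_corners hwp' hp')).resolve_left
      fun hwv' => hwv (Subtype.ext hwv')
  have h3 : vertexFactor f w (i + 3) = f p w := vertexFactor_eq (by rw [hp, hw]; abel)
  have h2 : vertexFactor f w (i + 2) = f p' w :=
    vertexFactor_eq (by rw [hp', hw, cornerOffset_sub]; abel)
  refine ⟨w, hw, ?_⟩
  rw [h2, h3]
  exact ⟨hmul, h0', h0⟩

/-- Without separable qudits, adjacent factors around a vertex commute or anticommute.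

Call an edge at a vertex *outgoing* if the factors of the two terms meeting along it neither commute
nor anticommute there, and *incoming* if they are nonzero with product zero. An outgoing edge is
incoming at its other end, and an incoming edge makes both perpendicular edges at the same vertex
outgoing. As the lattice is finite, counting shows that rotation by a right angle maps the incoming
edges onto the outgoing ones. So the edge opposite to an incoming one is incoming too, which is
impossible. -/
theorem vertexFactor_commOrAnticomm (hd : ∀ q, 0 < d q) (hsep : ∀ q, ¬ IsSeparableQudit h q)
    (v : L.Vertex) (i : Fin 4) :
    CommOrAnticomm (vertexFactor f v i) (vertexFactor f v (i + 1)) := by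
  set O : Set (L.Vertex × Fin 4) :=
    {x | ¬ CommOrAnticomm (vertexFactor f x.1 x.2) (vertexFactor f x.1 (x.2 + 1))} with hO
  set I : Set (L.Vertex × Fin 4) :=
    {x | vertexFactor f x.1 x.2 * vertexFactor f x.1 (x.2 + 1) = 0 ∧
      vertexFactor f x.1 x.2 ≠ 0 ∧ vertexFactor f x.1 (x.2 + 1) ≠ 0} with hI
  have hirr := fun v => vertexFactor_actsIrreducibly hf (hsep v)
  have hherm := vertexFactor_isHermitian hf
  have hdiag := vertexFactor_comm_diagonal hf hcommute
  have hperp : ∀ x ∈ I, (x.1, x.2 + 1) ∈ O ∧ (x.1, x.2 + 3) ∈ O := by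
    rintro ⟨v, i⟩ ⟨h0, h1, h2⟩
    have := not_commOrAnticomm_of_mul_eq_zero (hd v) (hirr v) (hherm v) (hdiag v) h0 h1 h2
    have h31 : i + 3 + 1 = i := (add_assoc i 3 1).trans (add_zero i)
    have h11 : i + 1 + 1 = i + 2 := add_assoc i 1 1
    simpa only [hO, Set.mem_ofPred_eq, h31, h11] using this
  have hflip : ∀ x : L.Vertex × Fin 4, ∃ y : L.Vertex × Fin 4, x ∈ O → y ∈ I ∧
      y.1.1 = x.1.1 + (cornerOffset (x.2 + 3) - cornerOffset x.2) ∧ y.2 = x.2 + 2 := by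
    rintro ⟨v, i⟩
    by_cases hx : (v, i) ∈ O
    · obtain ⟨w, hw, hmul⟩ := exists_vertexFactor_mul_eq_zero hf hcommute hx
      refine ⟨(w, i + 2), fun _ => ⟨?_, hw, rfl⟩⟩
      have h21 : i + 2 + 1 = i + 3 := add_assoc i 2 1
      simpa only [hI, Set.mem_ofPred_eq, h21] using hmul
    · exact ⟨(v, i), fun h => absurd h hx⟩
  choose φ hφ using hflip
  have himage : (fun x : L.Vertex × Fin 4 => (x.1, x.2 + 1)) '' I = O := by
    refine Set.image_eq_of_mutual_injOn (φ := φ) ?_ (fun x hx => (hperp x hx).1) ?_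
      fun x hx => (hφ x hx).1
    · rintro ⟨v, i⟩ ⟨w, j⟩ hvw
      simpa using hvw
    · rintro ⟨v, i⟩ hx ⟨w, j⟩ hy hxy
      obtain ⟨-, hv, hi⟩ := hφ _ hx
      obtain ⟨-, hw, hj⟩ := hφ _ hy
      rw [hxy] at hv hi
      obtain rfl : j = i := add_right_cancel (hj.symm.trans hi)
      exact Prod.ext (Subtype.ext (add_right_cancel (hv.symm.trans hw))) rfl
  have hIempty : ∀ x, x ∉ I := by
    rintro ⟨v, i⟩ hx
    have h3 := (hperp _ hx).2
    rw [← himage] at h3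
    obtain ⟨⟨w, j⟩, hy, hwj⟩ := h3
    obtain ⟨rfl, hj⟩ := Prod.ext_iff.mp hwj
    obtain rfl : j = i + 2 := add_right_cancel (hj.trans (add_assoc i 2 1).symm)
    have h21 : i + 2 + 1 = i + 3 := add_assoc i 2 1
    simp only [hI, Set.mem_ofPred_eq, h21] at hy
    exact mul_ne_zero_of_opposite (hd w) (hirr w) (hherm w) (hdiag w) hx.1 hx.2.1 hx.2.2 hy.1
  by_contra hvi
  have : (v, i) ∈ O := hvi
  exact hIempty _ (hφ _ this).1

theorem commuteRegular (hd : ∀ q, 0 < d q) (hsep : ∀ q, ¬ IsSeparableQudit h q)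
    (p p' : L.Plaquette) (q : L.Vertex) : CommOrAnticomm (f p q) (f p' q) := by
  by_cases hp : q ∈ L.corners p
  · by_cases hp' : q ∈ L.corners p'
    · obtain ⟨i, hi⟩ := mem_corners.mp hp
      obtain ⟨j, hj⟩ := mem_corners.mp hp'
      rw [← vertexFactor_eq (f := f) hi, ← vertexFactor_eq (f := f) hj]
      rcases Fin.four_cases i j with rfl | rfl | rfl | rfl
      · exact CommOrAnticomm.refl _
      · exact vertexFactor_commOrAnticomm hf hcommute hd hsep q i
      · exact Or.inl (vertexFactor_comm_diagonal hf hcommute q i)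
      · have := vertexFactor_commOrAnticomm hf hcommute hd hsep q (i + 3)
        rw [add_assoc, show (3 + 1 : Fin 4) = 0 from rfl, add_zero] at this
        exact this.symm
    · rw [(hf p').eq_one q hp']
      exact CommOrAnticomm.one_right _
  · rw [(hf p).eq_one q hp]
    exact (CommOrAnticomm.one_right _).symm

end SquareLattice

/-! ### Pauli strings in matrix form -/

section PauliMatrices

theorem pauliString_I (k : ℕ) : pauliString (fun _ : Fin k => Pauli.I) = 1 := by
  ext x y
  simp only [pauliString, tensorOp, Matrix.of_apply, Pauli.toMatrix]
  by_cases hxy : x = y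
  · subst hxy
    rw [Matrix.one_apply_eq]
    exact Finset.prod_eq_one fun i _ => Matrix.one_apply_eq _
  · obtain ⟨i, hi⟩ := Function.ne_iff.mp hxy
    rw [Matrix.one_apply_ne hxy]
    exact Finset.prod_eq_zero (Finset.mem_univ i) (Matrix.one_apply_ne hi)

/-- The unitary change of basis to a given orthonormal basis. -/
theorem OrthonormalBasis.exists_unitary_matrix {d : ℕ} {κ : Type} [Fintype κ] [DecidableEq κ]
    (b : OrthonormalBasis κ ℂ (EuclideanSpace ℂ (Fin d))) :
    ∃ U : Matrix κ (Fin d) ℂ, Uᴴ * U = 1 ∧ U * Uᴴ = 1 ∧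
      ∀ (A : SiteOp d) (P : Matrix κ κ ℂ),
        (∀ x, A.toEuclideanLin (b x) = ∑ y, P y x • b y) → U * A * Uᴴ = P := by
  have hcard : Fintype.card κ = Fintype.card (Fin d) := by
    rw [← Module.finrank_eq_card_basis b.toBasis, finrank_euclideanSpace]
  let U : Matrix κ (Fin d) ℂ := Matrix.of fun x i => star (b x i)
  have hU : ∀ (A : SiteOp d) (P : Matrix κ κ ℂ),
      (∀ x, A.toEuclideanLin (b x) = ∑ y, P y x • b y) → U * A * Uᴴ = P := by
    intro A P hAP
    ext y x
    have h1 : (U * A * Uᴴ) y x = inner ℂ (b y) (A.toEuclideanLin (b x)) := by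
      rw [EuclideanSpace.inner_eq_star_dotProduct, Matrix.mul_assoc, Matrix.mul_apply, dotProduct]
      refine Finset.sum_congr rfl fun i _ => ?_
      rw [mul_comm]
      simp [U, Matrix.mul_apply, Matrix.mulVec, dotProduct, Matrix.conjTranspose_apply]
    rw [h1, hAP, inner_sum]
    simp [inner_smul_right, orthonormal_iff_ite.mp b.orthonormal]
  have h1 : U * Uᴴ = 1 := by
    have := hU 1 1 (fun x => by simp [Matrix.one_apply])
    rwa [Matrix.mul_one] at this
  exact ⟨U, (Matrix.mul_eq_one_comm_of_card_eq _ _ _ hcard).mp h1, h1, hU⟩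

/-- If, on every qudit, the factors act irreducibly and pairwise commute or anticommute, then the
Hamiltonian is equivalent to a qubit stabilizer Hamiltonian. -/
theorem isEquivQubitStabilizer_of_commOrAnticomm {ι : Type} [Fintype ι] [DecidableEq ι]
    {d : ι → ℕ} (hd : ∀ q, 0 < d q) {T : Type} {h : T → QuditOp d} {S : T → Set ι}
    {f : T → ∀ q, SiteOp (d q)} (hf : ∀ t, IsFactorization (S t) (f t) (h t))
    (hca : ∀ t t' q, CommOrAnticomm (f t q) (f t' q))
    (hirr : ∀ q, ActsIrreducibly fun t : {t // q ∈ S t} => (f t.1 q).toEuclideanLin) :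
    IsEquivQubitStabilizer h := by
  have hsite : ∀ q, ∃ (m : ℕ) (U : Matrix (Fin m → Fin 2) (Fin (d q)) ℂ),
      (Uᴴ * U = 1 ∧ U * Uᴴ = 1) ∧ ∀ t, ∃ (c : ℝ) (s : Fin m → Pauli),
        U * f t q * Uᴴ = (c : ℂ) • pauliString s := by
    intro q
    have : Nonempty (Fin (d q)) := ⟨⟨0, hd q⟩⟩
    obtain ⟨m, b, hb⟩ := exists_pauli_basis _ (EuclideanSpace ℂ (Fin (d q)))
      (fun t : {t // q ∈ S t} => (f t.1 q).toEuclideanLin) le_rfl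
      (fun t => Matrix.isSymmetric_toEuclideanLin_iff.mpr ((hf t.1).isHermitian q))
      (fun t t' => by
        unfold CommOrAnticomm
        rw [Module.End.mul_eq_comp, Module.End.mul_eq_comp, ← Matrix.toLpLin_mul_same,
          ← Matrix.toLpLin_mul_same, ← map_neg]
        exact (hca t.1 t'.1 q).imp (congr_arg _) (congr_arg _))
      (hirr q)
    obtain ⟨U, hU1, hU2, hU⟩ := b.exists_unitary_matrix
    refine ⟨m, U, ⟨hU1, hU2⟩, fun t => ?_⟩
    by_cases ht : q ∈ S t
    · obtain ⟨c, s, hcs⟩ := hb ⟨t, ht⟩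
      refine ⟨c, s, hU _ _ fun x => ?_⟩
      rw [hcs x, Finset.smul_sum]
      simp [smul_smul]
    · exact ⟨1, fun _ => Pauli.I, by
        rw [(hf t).eq_one q ht, Matrix.mul_one, hU2, pauliString_I, Complex.ofReal_one, one_smul]⟩
  choose m U hU hUf using hsite
  refine ⟨m, U, hU, fun t => ?_⟩
  choose c s hcs using fun q => hUf q t
  refine ⟨∏ q, c q, s, ?_⟩
  rw [(hf t).eq_tensorOp, tensorOp_conjTranspose, tensorOp_mul, tensorOp_mul, Complex.ofReal_prod,
    ← tensorOp_smul]
  exact congr_arg tensorOp (funext hcs)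

end PauliMatrices

theorem mainTheorem4 (L : SquareLattice) (d : L.Vertex → ℕ) (hd : ∀ q, 0 < d q)
    (h : L.Plaquette → QuditOp d)
    (hfactorized : ∀ p, IsFactorized (L.corners p) (h p))
    (hcommute : ∀ p p', h p * h p' = h p' * h p)
    (hsep : ∀ q, ¬ IsSeparableQudit h q) :
    IsEquivQubitStabilizer h ∧
    ∀ f : L.Plaquette → ∀ q, SiteOp (d q),
      (∀ p, IsFactorization (L.corners p) (f p) (h p)) →
      (∀ p p', CommuteRegular (f p) (f p')) ∧
      (∀ p, ∀ q ∈ L.corners p, ∃ c : ℝ, f p q * f p q = (c : ℂ) • (1 : SiteOp (d q))) ∧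
      (∀ q, StarAlgebra.adjoin ℂ {A | ∃ p, q ∈ L.corners p ∧ A = f p q} = ⊤) := by
  constructor
  · choose f hf using hfactorized
    exact isEquivQubitStabilizer_of_commOrAnticomm hd hf
      (SquareLattice.commuteRegular hf hcommute hd hsep)
      fun q => actsIrreducibly_of_not_isSeparableQudit hf (hsep q)
  · intro f hf
    have hreg := SquareLattice.commuteRegular hf hcommute hd hsep
    have hirr := fun q => actsIrreducibly_of_not_isSeparableQudit hf (hsep q)
    refine ⟨fun p p' q => hreg p p' q, fun p q _ => ?_, fun q => ?_⟩
    · exact (hirr q).exists_mul_self_eq (hd q) ((hf p).isHermitian q) fun p' => hreg p p'.1 q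
    · rw [← (hirr q).starAlgebra_adjoin_eq_top (hd q)]
      congr 1
      ext A
      constructor
      · rintro ⟨p, hp, rfl⟩
        exact ⟨⟨p, hp⟩, rfl⟩
      · rintro ⟨p, rfl⟩
        exact ⟨p.1, p.2, rfl⟩
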